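/- Let $m\ge 1$ be an integer and $h>0$ (the step of the lattice $h\mathbb Z$). Put $$G_m(x)=\frac{x^{2m-1}\,\operatorname{sign}x}{2\,(2m-1)!},\qquad G_m[\beta]=G_m(h\beta)\quad(\beta\in\mathbb Z),$$ and let $D_m[\beta]$, $\beta\in\mathbb Z$, be the discrete analogue of the operator $d^{2m}/dx^{2m}$, i.e. the real function of the integer argument $\beta$ that satisfies $$h\sum_{\gamma\in\mathbb Z}D_m[\gamma]\,G_m[\beta-\gamma]=\begin{cases}1,&\beta=0,\\0,&\beta\neq0,\end{cases}\qquad \beta\in\mathbb Z,$$ with absolutely convergent series. Such a function exists and is unique. For every integer $0\le k\le 4m$ the series $\sum_{\beta\in\mathbb Z}D_m[\beta](h\beta)^k$ converges absolutely (with $(h\beta)^0=1$ for all $\beta$), and $$\sum_{\beta\in\mathbb Z}D_m[\beta](h\beta)^k=\begin{cases}0,&0\le k\le 2m-1,\\(2m)!,&k=2m,\\0,&2m+1\le k\le 4m-1,\\[2pt]\dfrac{h^{2m}(4m)!\,B_{2m}}{(2m)!},&k=4m,\end{cases}$$ where $B_{2m}$ is the Bernoulli number (so $B_2=1/6$, $B_4=-1/30$).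 -/

import Mathlib

/-- The function `G_m(x) = x^(2m-1) sign x / (2 (2m-1)!)` (for `m ≥ 1`), a fundamental solution of
`d^(2m)/dx^(2m)`. Its discrete version at step `h` is `β ↦ G_m(hβ)`. -/
noncomputable def fundamentalG (m : ℕ) (x : ℝ) : ℝ :=
  x ^ (2 * m - 1) * Real.sign x / (2 * ((2 * m - 1).factorial : ℝ))

/-- `D : ℤ → ℝ` is a discrete analogue of `d^(2m)/dx^(2m)` on the lattice of step `h`: it is inverse
to the discrete convolution with `h G_m[·]`, that is `h D * G_m = δ`, where
`(D * G_m)[β] = ∑ γ, D[γ] G_m(h(β - γ))`. `HasSum` says that each of these series converges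
(absolutely) and has the stated sum; nothing else is required of `D`. -/
def IsDiscreteAnalogue (m : ℕ) (h : ℝ) (D : ℤ → ℝ) : Prop :=
  ∀ β : ℤ, HasSum (fun γ : ℤ => h * (D γ * fundamentalG m (h * ((β - γ : ℤ) : ℝ))))
    (if β = 0 then 1 else 0)

open Polynomial in
/-- The Eulerian polynomials, normalised so that `∑ n ^ j z ^ n = A_j(z) / (1 - z) ^ (j + 1)`. -/
noncomputable def eulerianPoly : ℕ → ℂ[X]
  | 0 => 1
  | j + 1 => X * (1 - X) * derivative (eulerianPoly j) + ((j : ℂ[X]) + 1) * X * eulerianPoly j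

/-- The backward shift `(S f)(n) = f (n - 1)` on two-sided sequences. -/
noncomputable def seqShift : Module.End ℂ (ℤ → ℂ) :=
  LinearMap.funLeft ℂ ℂ (fun n : ℤ => n - 1)

@[simp] theorem seqShift_apply (f : ℤ → ℂ) (n : ℤ) : seqShift f n = f (n - 1) := rfl

/-- Multiplication of a sequence by its index. -/
noncomputable def seqMulIndex : Module.End ℂ (ℤ → ℂ) where
  toFun f n := n * f n
  map_add' f g := by ext n; simp [mul_add]
  map_smul' c f := by ext n; simp [mul_left_comm]

@[simp] theorem seqMulIndex_apply (f : ℤ → ℂ) (n : ℤ) : seqMulIndex f n = n * f n := rfl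

/-- The unit impulse at `0`. -/
noncomputable def seqDelta : ℤ → ℂ := Pi.single 0 1

theorem seqMulIndex_seqDelta : seqMulIndex seqDelta = 0 := by
  ext n
  by_cases hn : n = 0 <;> simp [seqDelta, hn]

section Shift
open Polynomial

theorem seqMulIndex_mul_seqShift :
    seqMulIndex * seqShift = seqShift * seqMulIndex + seqShift := by
  ext f n
  simp only [Module.End.mul_apply, LinearMap.add_apply, Pi.add_apply, seqMulIndex_apply,
    seqShift_apply]
  push_cast
  ring

theorem aeval_seqShift_mul_apply (p q : ℂ[X]) (f : ℤ → ℂ) :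
    aeval seqShift (p * q) f = aeval seqShift p (aeval seqShift q f) := by
  rw [map_mul, Module.End.mul_apply]

theorem seqMulIndex_mul_aeval (p : ℂ[X]) :
    seqMulIndex * aeval seqShift p =
      aeval seqShift p * seqMulIndex + aeval seqShift (X * derivative p) := by
  induction p using Polynomial.induction_on' with
  | add p q hp hq =>
    simp only [map_add, mul_add, add_mul, hp, hq]
    abel
  | monomial n a =>
    induction n with
    | zero => simp [monomial_zero_left, Algebra.commutes]
    | succ n ih =>
      have e : (monomial (n + 1) a : ℂ[X]) = monomial n a * X := by
        simp [monomial_mul_X]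
      have c1 : aeval seqShift (monomial n a) * seqShift =
          seqShift * aeval seqShift (monomial n a) := by
        have := congrArg (aeval seqShift) (mul_comm (monomial n a : ℂ[X]) X)
        rwa [map_mul, map_mul, aeval_X] at this
      rw [e, derivative_mul, derivative_X, mul_one, map_mul, aeval_X, ← mul_assoc, ih, add_mul,
        mul_assoc, seqMulIndex_mul_seqShift, mul_add, ← mul_assoc]
      simp only [mul_add, map_add, map_mul, aeval_X]
      rw [c1, mul_assoc, mul_assoc]
      abel

theorem one_sub_pow_seqMulIndex_pow (f : ℤ → ℂ)
    (hf : aeval seqShift (1 - X : ℂ[X]) f = seqDelta) (j : ℕ) :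
    aeval seqShift ((1 - X : ℂ[X]) ^ (j + 1)) ((seqMulIndex ^ j) f) =
      aeval seqShift (eulerianPoly j) seqDelta := by
  induction j with
  | zero => simpa [eulerianPoly] using hf
  | succ j ih =>
    rw [pow_succ' seqMulIndex, Module.End.mul_apply]
    generalize (seqMulIndex ^ j) f = g at ih ⊢
    have h1 := congrArg seqMulIndex ih
    have h2 := fun (p : ℂ[X]) (g : ℤ → ℂ) => LinearMap.congr_fun (seqMulIndex_mul_aeval p) g
    simp only [Module.End.mul_apply, LinearMap.add_apply] at h2
    rw [h2, h2, seqMulIndex_seqDelta, map_zero, zero_add] at h1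
    have h3 := congrArg (aeval seqShift (1 - X : ℂ[X])) h1
    have h4 : (1 - X : ℂ[X]) * (X * derivative ((1 - X : ℂ[X]) ^ (j + 1))) =
        -(((j : ℂ[X]) + 1) * X * (1 - X) ^ (j + 1)) := by
      rw [derivative_pow]
      simp
      ring
    have h5 : eulerianPoly (j + 1) = (1 - X) * (X * derivative (eulerianPoly j)) +
        ((j : ℂ[X]) + 1) * X * eulerianPoly j := by
      rw [eulerianPoly]
      ring
    rw [map_add, ← aeval_seqShift_mul_apply, ← aeval_seqShift_mul_apply,
      ← aeval_seqShift_mul_apply, h4, ← pow_succ', map_neg, LinearMap.neg_apply,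
      aeval_seqShift_mul_apply (((j : ℂ[X]) + 1) * X), ih, ← aeval_seqShift_mul_apply] at h3
    rw [h5, eq_add_of_add_neg_eq h3, map_add, LinearMap.add_apply]

end Shift

section Bernoulli
open PowerSeries

/-- The power series `X ^ (j + 1)` times the `j`-th derivative of `1 / (1 - exp X)`. -/
noncomputable def bernoulliDeriv (j : ℕ) : PowerSeries ℂ :=
  PowerSeries.mk fun n =>
    -((bernoulli n : ℂ) / (n.factorial : ℂ)) * ∏ i ∈ Finset.range j, ((n : ℂ) - (i + 1))

theorem bernoulliDeriv_succ (j : ℕ) :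
    bernoulliDeriv (j + 1) =
      X * d⁄dX ℂ (bernoulliDeriv j) - ((j : PowerSeries ℂ) + 1) * bernoulliDeriv j := by
  ext n
  have e : ((j : PowerSeries ℂ) + 1) = C ((j : ℂ) + 1) := by simp
  rw [e, map_sub, coeff_C_mul]
  cases n with
  | zero =>
    simp only [bernoulliDeriv, coeff_mk, Finset.prod_range_succ, coeff_zero_X_mul]
    push_cast
    ring
  | succ n =>
    rw [coeff_succ_X_mul, coeff_derivative]
    simp only [bernoulliDeriv, coeff_mk, Finset.prod_range_succ]
    push_cast
    ring

theorem X_pow_mul_aeval_exp_eulerianPoly (j : ℕ) :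
    X ^ (j + 1) * Polynomial.aeval (exp ℂ) (eulerianPoly j) =
      (1 - exp ℂ) ^ (j + 1) * bernoulliDeriv j := by
  induction j with
  | zero =>
    have h0 : bernoulliDeriv 0 = -bernoulliPowerSeries ℂ := by
      ext n
      simp [bernoulliDeriv, bernoulliPowerSeries]
    have := bernoulliPowerSeries_mul_exp_sub_one ℂ
    simp only [eulerianPoly, map_one, zero_add, pow_one, mul_one, h0]
    linear_combination -this
  | succ j ih =>
    have h := congrArg (d⁄dX ℂ) ih
    simp only [Derivation.leibniz, derivative_pow, Derivation.map_aeval, derivative_exp, map_sub,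
      Derivation.map_one_eq_zero, derivative_X, smul_eq_mul, Nat.add_sub_cancel] at h
    rw [bernoulliDeriv_succ, eulerianPoly]
    simp only [map_add, map_mul, map_sub, map_one, map_natCast, Polynomial.aeval_X]
    push_cast at h
    set E := exp ℂ
    set T := bernoulliDeriv j
    set Y := Polynomial.aeval E (eulerianPoly j)
    set Y' := Polynomial.aeval E (Polynomial.derivative (eulerianPoly j))
    linear_combination X * (1 - E) * h + ((j : PowerSeries ℂ) + 1) * (X * E - (1 - E)) * ih

end Bernoulli

section Nonvanishing
open Polynomial Complex

theorem ofReal_sub_I_ne_zero (c : ℝ) : (c : ℂ) - I ≠ 0 := by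
  intro h
  simpa using congrArg Complex.im h

/-- The Eulerian polynomial on the unit circle, in the Cayley parameter `c`. -/
noncomputable def eulerianCayley (j : ℕ) (c : ℝ) : ℂ :=
  (eulerianPoly j).eval ((c + I) / (c - I)) * (c - I) ^ (j + 1)

theorem hasDerivAt_eulerianCayley (j : ℕ) (c : ℝ) :
    HasDerivAt (eulerianCayley j) (eulerianCayley (j + 1) c / (1 + c ^ 2)) c := by
  have hc := ofReal_sub_I_ne_zero c
  have h0 : HasDerivAt (fun x : ℝ => (x : ℂ)) 1 c := Complex.ofRealCLM.hasDerivAt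
  have h1 := (h0.add_const I).div (h0.sub_const I) hc
  have h2 := ((eulerianPoly j).hasDerivAt ((c + I) / (c - I))).comp c h1
  have h3 := h2.mul ((h0.sub_const I).pow (j + 1))
  have hc2 : (1 : ℂ) + c ^ 2 = (c - I) * (c + I) := by ring_nf; simp; ring
  have hc' : (c : ℂ) + I ≠ 0 := by
    intro h
    simpa using congrArg Complex.im h
  refine h3.congr_deriv ?_
  rw [eulerianCayley, eulerianPoly, hc2]
  simp only [eval_add, eval_mul, eval_X, eval_sub, eval_one, eval_natCast, Function.comp,
    Nat.add_sub_cancel, Pi.pow_apply]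
  generalize eval _ (eulerianPoly j) = a
  generalize eval _ (derivative (eulerianPoly j)) = b
  push_cast
  field_simp
  ring

theorem eulerianCayley_succ {j : ℕ} {q : ℕ[X]} (h : ∀ c : ℝ, eulerianCayley j c = aeval (c : ℂ) q)
    (c : ℝ) : eulerianCayley (j + 1) c = aeval (c : ℂ) ((1 + X ^ 2) * derivative q) := by
  have h0 : HasDerivAt (fun x : ℝ => (x : ℂ)) 1 c := Complex.ofRealCLM.hasDerivAt
  have h1 : HasDerivAt (fun x : ℝ => aeval (x : ℂ) q) (aeval (c : ℂ) (derivative q)) c := by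
    have := ((q.map (algebraMap ℕ ℂ)).hasDerivAt (c : ℂ)).comp c h0
    simpa [derivative_map, Function.comp_def, eval_map_algebraMap] using this
  have h2 := hasDerivAt_eulerianCayley j c
  rw [show eulerianCayley j = fun x : ℝ => aeval (x : ℂ) q from funext h] at h2
  have hc : (1 : ℂ) + c ^ 2 ≠ 0 := by
    have : (0 : ℝ) < 1 + c ^ 2 := by positivity
    exact_mod_cast this.ne'
  have h3 := h2.unique h1
  rw [div_eq_iff hc] at h3
  rw [h3]
  simp [mul_comm]

theorem eulerianCayley_odd (i : ℕ) : ∃ r : ℕ[X], ∀ c : ℝ,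
    eulerianCayley (2 * i + 1) c = aeval (c : ℂ) (expand ℕ 2 (1 + X + r)) := by
  induction i with
  | zero =>
    refine ⟨0, fun c => ?_⟩
    have hc := ofReal_sub_I_ne_zero c
    simp only [eulerianCayley, eulerianPoly]
    simp
    field_simp
    ring_nf
    simp
    ring
  | succ i ih =>
    obtain ⟨r, hr⟩ := ih
    refine ⟨1 + 7 * X + 6 * X ^ 2 + (1 + X) * (4 * X * derivative r +
      (1 + X) * (2 * derivative r + 4 * X * derivative (derivative r))), fun c => ?_⟩
    have := eulerianCayley_succ (eulerianCayley_succ hr) c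
    rw [show 2 * (i + 1) + 1 = 2 * i + 1 + 1 + 1 by ring, this]
    congr 1
    simp only [derivative_expand, derivative_mul, map_add, map_mul, expand_X,
      map_one, derivative_one, derivative_X_pow, map_pow, map_ofNat]
    simp
    ring

theorem aeval_nat_nonneg (r : ℕ[X]) {t : ℝ} (ht : 0 ≤ t) : 0 ≤ aeval t r := by
  rw [aeval_eq_sum_range]
  exact Finset.sum_nonneg fun i _ => by positivity

theorem eulerianPoly_eval_one (j : ℕ) : (eulerianPoly j).eval 1 = (j.factorial : ℂ) := by
  induction j with
  | zero => simp [eulerianPoly]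
  | succ j ih => simp [eulerianPoly, ih, Nat.factorial_succ]

theorem eulerianPoly_eval_ne_zero {j : ℕ} (hj : Odd j) {z : ℂ} (hz : ‖z‖ = 1) :
    (eulerianPoly j).eval z ≠ 0 := by
  obtain ⟨i, rfl⟩ := hj
  by_cases h1 : z = 1
  · rw [h1, eulerianPoly_eval_one]
    exact_mod_cast Nat.factorial_ne_zero _
  have hsq : z.re ^ 2 + z.im ^ 2 = 1 := by
    have := Complex.sq_norm z
    rw [hz, Complex.normSq_apply] at this
    linarith
  have hre : 1 - z.re ≠ 0 := by
    intro h
    have hr : z.re = 1 := by linarith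
    have hi : z.im = 0 := by
      rw [hr] at hsq
      nlinarith
    exact h1 (Complex.ext (by simpa using hr) (by simpa using hi))
  set c : ℝ := z.im / (1 - z.re) with hcdef
  have hcm : c * (1 - z.re) = z.im := div_mul_cancel₀ _ hre
  have hc := ofReal_sub_I_ne_zero c
  have hzc : z = (c + I) / (c - I) := by
    rw [eq_div_iff hc]
    apply Complex.ext
    · simp
      linarith
    · simp
      have : (1 - z.re) * (z.im * c) = (1 - z.re) * (1 + z.re) := by
        linear_combination z.im * hcm + hsq
      linarith [mul_left_cancel₀ hre this]
  obtain ⟨r, hr⟩ := eulerianCayley_odd i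
  have h := hr c
  rw [eulerianCayley, ← hzc] at h
  intro h0
  rw [h0, zero_mul] at h
  have hpos : 0 < aeval (c ^ 2) (1 + X + r) := by
    have := aeval_nat_nonneg r (sq_nonneg c)
    simp only [map_add, map_one, aeval_X]
    positivity
  rw [expand_aeval, ← Complex.ofReal_pow, ← Complex.coe_algebraMap, aeval_algebraMap_apply] at h
  exact hpos.ne' (Complex.ofReal_injective (by simpa using h.symm))

end Nonvanishing

/-- Faster than polynomial decay of a two-sided sequence. -/
def RapidDecay (f : ℤ → ℂ) : Prop :=
  ∀ N : ℕ, ∃ C : ℝ, ∀ n : ℤ, ‖f n‖ * (1 + |(n : ℝ)|) ^ N ≤ C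

namespace RapidDecay

theorem add {f g : ℤ → ℂ} (hf : RapidDecay f) (hg : RapidDecay g) : RapidDecay (f + g) := by
  intro N
  obtain ⟨C, hC⟩ := hf N
  obtain ⟨B, hB⟩ := hg N
  refine ⟨C + B, fun n => ?_⟩
  calc ‖(f + g) n‖ * (1 + |(n : ℝ)|) ^ N ≤ (‖f n‖ + ‖g n‖) * (1 + |(n : ℝ)|) ^ N := by
        gcongr
        exact norm_add_le _ _
    _ ≤ C + B := by
        rw [add_mul]
        exact add_le_add (hC n) (hB n)

theorem smul {f : ℤ → ℂ} (hf : RapidDecay f) (c : ℂ) : RapidDecay (c • f) := by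
  intro N
  obtain ⟨C, hC⟩ := hf N
  refine ⟨‖c‖ * C, fun n => ?_⟩
  rw [Pi.smul_apply, smul_eq_mul, norm_mul, mul_assoc]
  exact mul_le_mul_of_nonneg_left (hC n) (norm_nonneg _)

theorem one_add_abs_le (n k : ℤ) :
    1 + |(n : ℝ)| ≤ (1 + |((n + k : ℤ) : ℝ)|) * (1 + |(k : ℝ)|) := by
  have h : |(n : ℝ)| ≤ |((n + k : ℤ) : ℝ)| + |(k : ℝ)| := by
    have := abs_sub ((n + k : ℤ) : ℝ) (k : ℝ)
    rwa [show ((n + k : ℤ) : ℝ) - k = n by push_cast; ring] at this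
  nlinarith [mul_nonneg (abs_nonneg ((n + k : ℤ) : ℝ)) (abs_nonneg (k : ℝ))]

theorem norm_translate_le {f : ℤ → ℂ} {N : ℕ} {C : ℝ}
    (hC : ∀ n : ℤ, ‖f n‖ * (1 + |(n : ℝ)|) ^ N ≤ C) (n k : ℤ) :
    ‖f (n + k)‖ * (1 + |(n : ℝ)|) ^ N ≤ C * (1 + |(k : ℝ)|) ^ N := by
  calc ‖f (n + k)‖ * (1 + |(n : ℝ)|) ^ N
      ≤ ‖f (n + k)‖ * ((1 + |((n + k : ℤ) : ℝ)|) * (1 + |(k : ℝ)|)) ^ N := by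
        gcongr
        exact one_add_abs_le n k
    _ = ‖f (n + k)‖ * (1 + |((n + k : ℤ) : ℝ)|) ^ N * (1 + |(k : ℝ)|) ^ N := by
        rw [mul_pow, mul_assoc]
    _ ≤ C * (1 + |(k : ℝ)|) ^ N := by
        gcongr
        exact hC _

theorem translate {f : ℤ → ℂ} (hf : RapidDecay f) (k : ℤ) : RapidDecay fun n => f (n + k) := by
  intro N
  obtain ⟨C, hC⟩ := hf N
  exact ⟨_, fun n => norm_translate_le hC n k⟩

theorem aeval_seqShift {f : ℤ → ℂ} (hf : RapidDecay f) (p : Polynomial ℂ) :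
    RapidDecay (Polynomial.aeval seqShift p f) := by
  induction p using Polynomial.induction_on with
  | C a => simpa [Algebra.algebraMap_eq_smul_one] using hf.smul a
  | add p q hp hq => simpa using hp.add hq
  | monomial n a ih =>
    rw [pow_succ', mul_left_comm, aeval_seqShift_mul_apply, Polynomial.aeval_X]
    exact ih.translate (-1)

theorem seqDelta : RapidDecay seqDelta := by
  intro N
  refine ⟨1, fun n => ?_⟩
  by_cases hn : n = 0 <;> simp [_root_.seqDelta, hn]

theorem summable_mul {f g : ℤ → ℂ} (hf : RapidDecay f) {C : ℝ} {N : ℕ}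
    (hg : ∀ n : ℤ, ‖g n‖ ≤ C * (1 + |(n : ℝ)|) ^ N) : Summable fun n => f n * g n := by
  obtain ⟨B, hB⟩ := hf (N + 2)
  have hC : 0 ≤ C := by simpa using (norm_nonneg _).trans (hg 0)
  have hs : Summable fun n : ℤ => B * C * (1 / (n : ℝ) ^ 2) :=
    (Real.summable_one_div_int_pow.mpr one_lt_two).mul_left _
  refine Summable.of_norm_bounded_eventually hs ?_
  filter_upwards [(Set.finite_singleton (0 : ℤ)).compl_mem_cofinite] with n hn
  have hn0 : (0 : ℝ) < (n : ℝ) ^ 2 := by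
    have : (n : ℝ) ≠ 0 := by exact_mod_cast hn
    positivity
  rw [norm_mul, mul_one_div, le_div_iff₀ hn0]
  calc ‖f n‖ * ‖g n‖ * (n : ℝ) ^ 2
      ≤ ‖f n‖ * (C * (1 + |(n : ℝ)|) ^ N) * (1 + |(n : ℝ)|) ^ 2 := by
        gcongr ‖f n‖ * ?_ * ?_
        · exact hg n
        · rw [← sq_abs (n : ℝ)]
          gcongr
          linarith
    _ = ‖f n‖ * (1 + |(n : ℝ)|) ^ (N + 2) * C := by ring
    _ ≤ B * C := by
        gcongr
        exact hB n

theorem summable_mul_pow {f : ℤ → ℂ} (hf : RapidDecay f) (k : ℕ) :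
    Summable fun n : ℤ => f n * (n : ℂ) ^ k := by
  refine hf.summable_mul (C := 1) (N := k) fun n => ?_
  rw [norm_pow, Complex.norm_intCast, one_mul]
  gcongr
  linarith

theorem summable_geometric_translate {f : ℤ → ℂ} (hf : RapidDecay f) {q : ℂ} (hq : ‖q‖ < 1)
    (σ : ℤ) (hσ : |σ| = 1) :
    (∀ n : ℤ, Summable fun k : ℕ => q ^ k * f (n + σ * k)) ∧
      RapidDecay fun n => ∑' k : ℕ, q ^ k * f (n + σ * k) := by
  have habs (k : ℕ) : |((σ * k : ℤ) : ℝ)| = k := by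
    have : |(σ : ℝ)| = 1 := by exact_mod_cast hσ
    push_cast
    rw [abs_mul, this, one_mul, Nat.abs_cast]
  have key (N : ℕ) : ∃ C : ℝ, Summable (fun k : ℕ => ‖q‖ ^ k * (C * (1 + (k : ℝ)) ^ N)) ∧
      ∀ (n : ℤ) (k : ℕ), ‖q ^ k * f (n + σ * k)‖ * (1 + |(n : ℝ)|) ^ N ≤
        ‖q‖ ^ k * (C * (1 + (k : ℝ)) ^ N) := by
    obtain ⟨C, hC⟩ := hf N
    refine ⟨C, ?_, fun n k => ?_⟩
    · have hq' : ‖‖q‖‖ < 1 := by simpa using hq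
      have h1 := summable_norm_mul_geometric_of_norm_lt_one (k := N) (r := ‖q‖) hq'
        (u := fun n => (1 + n) ^ N) (by
          push_cast
          refine Asymptotics.IsBigO.pow ?_ N
          refine Asymptotics.IsBigO.of_bound 2 ?_
          filter_upwards [Filter.eventually_ge_atTop 1] with n hn
          have : (1 : ℝ) ≤ n := by exact_mod_cast hn
          rw [Real.norm_of_nonneg (by positivity), Real.norm_of_nonneg (by positivity)]
          linarith)
      refine (h1.of_norm.mul_left C).congr fun k => ?_
      push_cast
      ring
    · have := norm_translate_le hC n (σ * k)
      rw [habs] at this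
      rw [norm_mul, norm_pow, mul_assoc]
      gcongr
  have hsum (n : ℤ) : Summable fun k : ℕ => ‖q ^ k * f (n + σ * k)‖ := by
    obtain ⟨C, h1, h2⟩ := key 0
    exact Summable.of_nonneg_of_le (fun _ => norm_nonneg _) (fun k => by simpa using h2 n k) h1
  refine ⟨fun n => (hsum n).of_norm, fun N => ?_⟩
  obtain ⟨C, h1, h2⟩ := key N
  refine ⟨_, fun n => le_trans ?_ (((hsum n).mul_right _).tsum_le_tsum (h2 n) h1)⟩
  rw [tsum_mul_right]
  gcongr
  exact norm_tsum_le_tsum_norm (hsum n)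

open Polynomial in
theorem exists_linear {f : ℤ → ℂ} (hf : RapidDecay f) {r : ℂ} (hr : ‖r‖ ≠ 1) :
    ∃ u, RapidDecay u ∧ aeval seqShift (X - C r) u = f := by
  have hop (u : ℤ → ℂ) (n : ℤ) : aeval seqShift (X - C r) u n = u (n - 1) - r * u n := by
    simp [Algebra.algebraMap_eq_smul_one]
  rcases lt_or_gt_of_ne hr with hr | hr
  · obtain ⟨hs, hd⟩ := (hf.translate 1).summable_geometric_translate hr 1 (by simp)
    refine ⟨_, hd, funext fun n => ?_⟩
    rw [hop, (hs (n - 1)).tsum_eq_zero_add, ← tsum_mul_left]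
    have (k : ℕ) : r ^ (k + 1) * f (n - 1 + 1 * ((k + 1 : ℕ) : ℤ) + 1) =
        r * (r ^ k * f (n + 1 * (k : ℤ) + 1)) := by
      rw [pow_succ', mul_assoc]
      congr 3
      push_cast
      ring
    simp only [this]
    simp
  · have hr0 : r ≠ 0 := by
      rintro rfl
      simp at hr
      linarith
    have hq : ‖r⁻¹‖ < 1 := by
      rw [norm_inv]
      exact inv_lt_one_of_one_lt₀ hr
    obtain ⟨hs, hd⟩ := hf.summable_geometric_translate hq (-1) (by simp)
    refine ⟨_, hd.smul (-r⁻¹), funext fun n => ?_⟩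
    rw [hop]
    simp only [Pi.smul_apply, smul_eq_mul]
    rw [(hs n).tsum_eq_zero_add]
    have (k : ℕ) : r⁻¹ ^ (k + 1) * f (n + -1 * ((k + 1 : ℕ) : ℤ)) =
        r⁻¹ * (r⁻¹ ^ k * f (n - 1 + -1 * (k : ℤ))) := by
      rw [pow_succ', mul_assoc]
      congr 3
      push_cast
      ring
    simp only [this, tsum_mul_left]
    field_simp
    simp

open Polynomial in
theorem exists_aeval_eq {p : ℂ[X]} (hp : ∀ z : ℂ, ‖z‖ = 1 → p.eval z ≠ 0) {f : ℤ → ℂ}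
    (hf : RapidDecay f) : ∃ u, RapidDecay u ∧ aeval seqShift p u = f := by
  have hp0 : p ≠ 0 := by
    rintro rfl
    exact hp 1 (by simp) (by simp)
  have hroots (s : Multiset ℂ) (hs : ∀ r ∈ s, ‖r‖ ≠ 1) (f : ℤ → ℂ) (hf : RapidDecay f) :
      ∃ u, RapidDecay u ∧ aeval seqShift (s.map fun r => X - C r).prod u = f := by
    induction s using Multiset.induction_on generalizing f with
    | empty => exact ⟨f, hf, by simp⟩
    | cons r s ih =>
      obtain ⟨v, hv, hvf⟩ := hf.exists_linear (hs r (by simp))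
      obtain ⟨u, hu, huv⟩ := ih (fun r hr => hs r (by simp [hr])) v hv
      refine ⟨u, hu, ?_⟩
      rw [Multiset.map_cons, Multiset.prod_cons, aeval_seqShift_mul_apply, huv, hvf]
  obtain ⟨u, hu, huf⟩ := hroots p.roots (fun r hr h1 => hp r h1 (isRoot_of_mem_roots hr))
    (p.leadingCoeff⁻¹ • f) (hf.smul _)
  refine ⟨u, hu, ?_⟩
  rw [(IsAlgClosed.splits p).eq_prod_roots, aeval_seqShift_mul_apply, huf]
  simp [Algebra.algebraMap_eq_smul_one, smul_smul, hp0]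

end RapidDecay

section Moments
open PowerSeries

/-- The exponential moment generating series `∑ f(n) exp (n X)`. -/
noncomputable def momentSeries (f : ℤ → ℂ) : PowerSeries ℂ :=
  PowerSeries.mk fun k => (∑' n : ℤ, f n * (n : ℂ) ^ k) / (k.factorial : ℂ)

theorem momentSeries_add {f g : ℤ → ℂ} (hf : RapidDecay f) (hg : RapidDecay g) :
    momentSeries (f + g) = momentSeries f + momentSeries g := by
  ext k
  simp only [momentSeries, coeff_mk, map_add, Pi.add_apply, add_mul]
  rw [(hf.summable_mul_pow k).tsum_add (hg.summable_mul_pow k), add_div]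

theorem momentSeries_smul (c : ℂ) (f : ℤ → ℂ) :
    momentSeries (c • f) = C c * momentSeries f := by
  ext k
  simp only [momentSeries, coeff_mk, coeff_C_mul, Pi.smul_apply, smul_eq_mul, mul_assoc]
  rw [tsum_mul_left, mul_div_assoc]

theorem add_one_pow_div_factorial (x : ℂ) (k : ℕ) :
    (x + 1) ^ k / (k.factorial : ℂ) = ∑ ij ∈ Finset.HasAntidiagonal.antidiagonal k,
      1 / (ij.1.factorial : ℂ) * (x ^ ij.2 / (ij.2.factorial : ℂ)) := by
  have h := congrArg (coeff k) (exp_mul_exp_eq_exp_add (A := ℂ) 1 x)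
  simp only [coeff_mul, coeff_rescale, coeff_exp] at h
  simp only [map_div₀, map_one, map_natCast, one_pow, one_mul] at h
  rw [add_comm, div_eq_mul_one_div, ← h]
  refine Finset.sum_congr rfl fun ij _ => ?_
  rw [mul_one_div]

theorem momentSeries_seqShift {f : ℤ → ℂ} (hf : RapidDecay f) :
    momentSeries (seqShift f) = exp ℂ * momentSeries f := by
  ext k
  rw [coeff_mul]
  simp only [momentSeries, coeff_mk, coeff_exp, seqShift_apply]
  rw [← (Equiv.addRight (1 : ℤ)).tsum_eq, ← tsum_div_const]
  simp only [Equiv.coe_addRight, add_sub_cancel_right, mul_div_assoc, Int.cast_add, Int.cast_one,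
    add_one_pow_div_factorial, Finset.mul_sum]
  rw [Summable.tsum_finsetSum]
  · refine Finset.sum_congr rfl fun ij _ => ?_
    rw [← tsum_div_const, ← tsum_mul_left]
    refine tsum_congr fun n => ?_
    simp
    ring
  · intro ij _
    refine ((hf.summable_mul_pow ij.2).mul_left
      (1 / (ij.1.factorial : ℂ) / (ij.2.factorial : ℂ))).congr fun n => ?_
    ring

theorem momentSeries_aeval {f : ℤ → ℂ} (hf : RapidDecay f) (p : Polynomial ℂ) :
    momentSeries (Polynomial.aeval seqShift p f) =
      Polynomial.aeval (exp ℂ) p * momentSeries f := by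
  induction p using Polynomial.induction_on with
  | C a => simp [Algebra.algebraMap_eq_smul_one, momentSeries_smul]
  | add p q hp hq =>
    simp only [map_add, LinearMap.add_apply, add_mul]
    rw [momentSeries_add (hf.aeval_seqShift p) (hf.aeval_seqShift q), hp, hq]
  | monomial n a ih =>
    rw [pow_succ', mul_left_comm, aeval_seqShift_mul_apply, Polynomial.aeval_X,
      momentSeries_seqShift (hf.aeval_seqShift _), ih, map_mul _ Polynomial.X, Polynomial.aeval_X,
      mul_assoc]

theorem momentSeries_seqDelta : momentSeries seqDelta = 1 := by
  ext k
  rw [momentSeries, coeff_mk, tsum_eq_single 0 (by intro n hn; simp [seqDelta, hn]), coeff_one]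
  cases k <;> simp [seqDelta]

end Moments

/-- `E * g = t` as an absolutely convergent discrete convolution on `ℤ`. -/
def IsConv (E g t : ℤ → ℂ) : Prop :=
  ∀ β : ℤ, HasSum (fun γ : ℤ => E γ * g (β - γ)) (t β)

namespace IsConv
open Polynomial

theorem unique {E g t t' : ℤ → ℂ} (h : IsConv E g t) (h' : IsConv E g t') : t = t' :=
  funext fun β => (h β).unique (h' β)

theorem symm {E g t : ℤ → ℂ} (h : IsConv E g t) : IsConv g E t := by
  intro β
  rw [← (Equiv.subLeft β).hasSum_iff]
  simpa [Function.comp_def, mul_comm] using h β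

theorem smul_right {E g t : ℤ → ℂ} (h : IsConv E g t) (c : ℂ) : IsConv E (c • g) (c • t) := by
  intro β
  simpa [mul_left_comm] using (h β).mul_left c

theorem smul_left {E g t : ℤ → ℂ} (h : IsConv E g t) (c : ℂ) : IsConv (c • E) g (c • t) :=
  (h.symm.smul_right c).symm

theorem aeval_right {E g t : ℤ → ℂ} (h : IsConv E g t) (p : ℂ[X]) :
    IsConv E (aeval seqShift p g) (aeval seqShift p t) := by
  induction p using Polynomial.induction_on with
  | C a => simpa [Algebra.algebraMap_eq_smul_one] using h.smul_right a
  | add p q hp hq =>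
    intro β
    simpa [mul_add] using (hp β).add (hq β)
  | monomial n a ih =>
    rw [pow_succ', mul_left_comm, aeval_seqShift_mul_apply X, aeval_seqShift_mul_apply X, aeval_X]
    intro β
    have := ih (β - 1)
    simp only [seqShift_apply]
    simpa only [sub_right_comm] using this

theorem aeval_left {E g t : ℤ → ℂ} (h : IsConv E g t) (p : ℂ[X]) :
    IsConv (aeval seqShift p E) g (aeval seqShift p t) :=
  (h.symm.aeval_right p).symm

theorem seqDelta_right (E : ℤ → ℂ) : IsConv E seqDelta E := by
  intro β
  convert hasSum_single β (f := fun γ : ℤ => E γ * seqDelta (β - γ)) ?_ using 1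
  · simp [seqDelta]
  · intro γ hγ
    simp [seqDelta, sub_eq_zero, hγ.symm]

theorem seqDelta_left (E : ℤ → ℂ) : IsConv seqDelta E E :=
  (seqDelta_right E).symm

/-- A summable convolution inverse of `g` is determined by a factorisation `q(S) g = c p(S) δ`
and a rapidly decaying inverse `u` of `p(S)`. -/
theorem eq_of_seqDelta {E g u : ℤ → ℂ} {p q : ℂ[X]} {c : ℂ} (hc : c ≠ 0) (hE : Summable E)
    (h : IsConv E g seqDelta) (hu : RapidDecay u) (hpu : aeval seqShift p u = seqDelta)
    (hg : aeval seqShift q g = c • aeval seqShift p seqDelta) :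
    E = c⁻¹ • aeval seqShift q u := by
  have h1 := h.aeval_right q
  rw [hg] at h1
  have h2 : aeval seqShift p E = c⁻¹ • aeval seqShift q seqDelta := by
    rw [h1.unique (((seqDelta_right E).aeval_right p).smul_right c), smul_smul,
      inv_mul_cancel₀ hc, one_smul]
  obtain ⟨B, hB⟩ := hu 0
  have h3 : IsConv E u fun β => ∑' γ : ℤ, E γ * u (β - γ) := by
    intro β
    refine (Summable.of_norm_bounded (hE.norm.mul_left B) fun γ => ?_).hasSum
    rw [norm_mul, mul_comm]
    gcongr
    simpa using hB (β - γ)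
  have h4 := h3.aeval_right p
  rw [hpu] at h4
  have h5 := h3.aeval_left p
  rw [← (seqDelta_right E).unique h4, h2] at h5
  exact h5.unique (((seqDelta_left u).aeval_left q).smul_left c⁻¹)

/-- Conversely the formula of `IsConv.eq_of_seqDelta` defines a convolution inverse of `g`. -/
theorem of_factorisation {g u : ℤ → ℂ} {p q : ℂ[X]} {c : ℂ} (hc : c ≠ 0) {C : ℝ} {N : ℕ}
    (hgN : ∀ n : ℤ, ‖g n‖ ≤ C * (1 + |(n : ℝ)|) ^ N)
    (hu : RapidDecay u) (hpu : aeval seqShift p u = seqDelta)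
    (hg : aeval seqShift q g = c • aeval seqShift p seqDelta) :
    IsConv (c⁻¹ • aeval seqShift q u) g seqDelta := by
  have h1 : IsConv u g fun β => ∑' γ : ℤ, u γ * g (β - γ) := by
    intro β
    have hC : 0 ≤ C := by simpa using (norm_nonneg _).trans (hgN 0)
    refine (hu.summable_mul (C := C * (1 + |(β : ℝ)|) ^ N) (N := N) fun n => ?_).hasSum
    rw [mul_assoc, ← mul_pow]
    refine (hgN _).trans ?_
    gcongr
    have := RapidDecay.one_add_abs_le (β - n) n
    have h2 : |((β - n : ℤ) : ℝ)| ≤ |(β : ℝ)| + |(n : ℝ)| := by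
      push_cast
      exact abs_sub _ _
    nlinarith [mul_nonneg (abs_nonneg (β : ℝ)) (abs_nonneg (n : ℝ))]
  have h2 := (h1.aeval_left q).smul_left c⁻¹
  have h3 := h1.aeval_right q
  rw [hg] at h3
  rw [h3.unique (((seqDelta_right u).aeval_right p).smul_right c), smul_smul,
    inv_mul_cancel₀ hc, one_smul, hpu] at h2
  exact h2

end IsConv

section Fundamental
open Polynomial

theorem seqMulIndex_pow_apply (j : ℕ) (f : ℤ → ℂ) (n : ℤ) :
    (seqMulIndex ^ j) f n = (n : ℂ) ^ j * f n := by
  induction j with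
  | zero => simp
  | succ j ih => rw [pow_succ', Module.End.mul_apply, seqMulIndex_apply, ih, pow_succ', mul_assoc]

theorem one_sub_pow_fundamentalG {m : ℕ} (hm : 1 ≤ m) {h : ℝ} (hh : 0 < h) :
    aeval seqShift ((1 - X : ℂ[X]) ^ (2 * m)) (fun n : ℤ => (fundamentalG m (h * n) : ℂ)) =
      ((h : ℂ) ^ (2 * m - 1) / ((2 * m - 1).factorial : ℂ)) •
        aeval seqShift (eulerianPoly (2 * m - 1)) seqDelta := by
  set f : ℤ → ℂ := fun n => if 0 ≤ n then 1 / 2 else -1 / 2 with hf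
  have hfd : aeval seqShift (1 - X : ℂ[X]) f = seqDelta := by
    ext n
    simp only [map_sub, map_one, aeval_X, LinearMap.sub_apply, Module.End.one_apply, Pi.sub_apply,
      seqShift_apply, hf, seqDelta]
    rcases lt_trichotomy n 0 with hn | rfl | hn
    · have h1 : ¬ 1 ≤ n := by omega
      simp [hn.ne, hn.not_ge, h1]
    · norm_num
    · have h1 : 1 ≤ n := hn
      simp [hn.ne', hn.le, h1]
  have h1 := one_sub_pow_seqMulIndex_pow f hfd (2 * m - 1)
  rw [Nat.sub_add_cancel (by omega)] at h1
  rw [← h1, ← map_smul]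
  congr 1
  ext n
  rw [Pi.smul_apply, seqMulIndex_pow_apply, fundamentalG, hf]
  have hfac : ((2 * m - 1).factorial : ℂ) ≠ 0 := by exact_mod_cast Nat.factorial_ne_zero _
  rcases lt_trichotomy n 0 with hn | rfl | hn
  · have : h * n < 0 := mul_neg_of_pos_of_neg hh (by exact_mod_cast hn)
    simp [hn.not_ge, Real.sign_of_neg this, mul_pow]
    field_simp
  · have : 2 * m - 1 ≠ 0 := by omega
    simp [this]
  · have : 0 < h * n := mul_pos hh (by exact_mod_cast hn)
    simp [hn.le, Real.sign_of_pos this, mul_pow]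
    field_simp

theorem abs_fundamentalG (m : ℕ) {h : ℝ} (hh : 0 < h) {n : ℤ} (hn : n ≠ 0) :
    |fundamentalG m (h * n)| =
      h ^ (2 * m - 1) / (2 * ((2 * m - 1).factorial : ℝ)) * |(n : ℝ)| ^ (2 * m - 1) := by
  have hs : |Real.sign (h * n)| = 1 := by
    rcases lt_or_gt_of_ne hn with hn | hn
    · simp [Real.sign_of_neg (mul_neg_of_pos_of_neg hh (by exact_mod_cast hn : (n : ℝ) < 0))]
    · simp [Real.sign_of_pos (mul_pos hh (by exact_mod_cast hn : (0 : ℝ) < n))]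
  rw [fundamentalG, abs_div, abs_mul, hs, abs_pow, abs_mul, abs_of_pos hh,
    abs_of_pos (by positivity : (0 : ℝ) < 2 * ((2 * m - 1).factorial : ℝ))]
  ring

theorem norm_fundamentalG_le (m : ℕ) {h : ℝ} (hh : 0 < h) (n : ℤ) :
    ‖(fundamentalG m (h * n) : ℂ)‖ ≤
      h ^ (2 * m - 1) / (2 * ((2 * m - 1).factorial : ℝ)) * (1 + |(n : ℝ)|) ^ (2 * m - 1) := by
  rw [Complex.norm_real, Real.norm_eq_abs]
  by_cases hn : n = 0
  · subst hn
    simp only [fundamentalG, Int.cast_zero, mul_zero, Real.sign_zero, zero_div, abs_zero]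
    positivity
  · rw [abs_fundamentalG m hh hn]
    gcongr
    linarith

theorem IsDiscreteAnalogue.summable {m : ℕ} {h : ℝ} (hh : 0 < h) {D : ℤ → ℝ}
    (hD : IsDiscreteAnalogue m h D) : Summable D := by
  set c : ℝ := h ^ (2 * m - 1) / (2 * ((2 * m - 1).factorial : ℝ)) with hc
  have hc0 : 0 < c := by positivity
  refine Summable.of_norm_bounded_eventually (((hD 0).summable.norm).mul_left (h * c)⁻¹) ?_
  filter_upwards [(Set.finite_singleton (0 : ℤ)).compl_mem_cofinite] with n hn
  have hn0 : n ≠ 0 := hn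
  have h1 : (1 : ℝ) ≤ |(n : ℝ)| := by exact_mod_cast Int.one_le_abs hn0
  rw [norm_mul, norm_mul, Real.norm_of_nonneg hh.le, Real.norm_eq_abs (fundamentalG _ _),
    abs_fundamentalG m hh (by simpa using hn0), ← hc]
  have h2 : (1 : ℝ) ≤ |((0 - n : ℤ) : ℝ)| ^ (2 * m - 1) := by
    apply one_le_pow₀
    simpa using h1
  calc ‖D n‖ = (h * c)⁻¹ * (h * (‖D n‖ * (c * 1))) := by field_simp
    _ ≤ _ := by gcongr

theorem isDiscreteAnalogue_iff {m : ℕ} {h : ℝ} {D : ℤ → ℝ} :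
    IsDiscreteAnalogue m h D ↔
      IsConv (fun γ => (h : ℂ) * D γ) (fun n : ℤ => (fundamentalG m (h * n) : ℂ)) seqDelta := by
  refine forall_congr' fun β => ?_
  rw [← Complex.hasSum_ofReal]
  simp only [Complex.ofReal_mul, mul_assoc]
  congr!
  by_cases hβ : β = 0 <;> simp [hβ, seqDelta]

end Fundamental

section Main
open PowerSeries

/-- The leading coefficients of the reciprocal of a series `1 - b X ^ n + O(X ^ (n + 1))`. -/
theorem coeff_of_mul_eq_X_pow {n : ℕ} (hn : 0 < n) {P R : PowerSeries ℂ}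
    (h : P * (1 + X ^ n * R) = X ^ n) {k : ℕ} (hk : k ≤ 2 * n) :
    coeff k P = if k = n then 1 else if k = 2 * n then -coeff 0 R else 0 := by
  have h1 : P = X ^ n - X ^ (2 * n) * R + X ^ (3 * n) * (R ^ 2 * (1 - R * P)) := by
    have h0 : P = X ^ n * (1 - R * P) := by linear_combination h
    have h2 : P = X ^ n * (1 - R * (X ^ n * (1 - R * (X ^ n * (1 - R * P))))) := by
      rw [← h0, ← h0, ← h0]
    rw [show (3 : ℕ) * n = n + n + n by ring, two_mul, pow_add, pow_add]
    linear_combination h2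
  rw [h1]
  simp only [map_add, map_sub, coeff_X_pow, coeff_X_pow_mul']
  rw [if_neg (by omega : ¬ 3 * n ≤ k), add_zero]
  by_cases h3 : k = n
  · rw [if_pos h3, if_neg (by omega), sub_zero, if_pos h3]
  · rw [if_neg h3]
    by_cases h4 : k = 2 * n
    · rw [if_pos h4.ge, if_neg h3, if_pos h4, h4, Nat.sub_self, zero_sub]
    · rw [if_neg (by omega), if_neg h3, if_neg h4, sub_zero]

theorem bernoulliDeriv_odd {m : ℕ} (hm : 1 ≤ m) : ∃ R : PowerSeries ℂ,
    bernoulliDeriv (2 * m - 1) =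
      C ((2 * m - 1).factorial : ℂ) * (1 + X ^ (2 * m) * R) ∧
    coeff 0 R = -((bernoulli (2 * m) : ℂ) / ((2 * m).factorial : ℂ)) := by
  set j := 2 * m - 1 with hj
  have hjm : 2 * m = j + 1 := by omega
  have hfac : (j.factorial : ℂ) ≠ 0 := by exact_mod_cast Nat.factorial_ne_zero _
  have hprod : ∏ i ∈ Finset.range j, (((j + 1 : ℕ) : ℂ) - (i + 1)) = j.factorial := by
    rw [← Finset.prod_range_reflect, ← Finset.prod_range_add_one_eq_factorial]
    push_cast
    refine Finset.prod_congr rfl fun i hi => ?_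
    have := Finset.mem_range.mp hi
    rw [Nat.sub_sub, Nat.cast_sub (show 1 + i ≤ j by omega)]
    push_cast
    ring
  have hprod0 : ∏ i ∈ Finset.range j, (((0 : ℕ) : ℂ) - (i + 1)) = -j.factorial := by
    have hodd : Odd j := ⟨m - 1, by omega⟩
    rw [← Finset.prod_range_add_one_eq_factorial]
    push_cast
    have : ∀ i : ℕ, (0 : ℂ) - (i + 1) = (-1) * (i + 1) := fun i => by ring
    simp only [this]
    rw [Finset.prod_mul_distrib, Finset.prod_const, Finset.card_range, hodd.neg_one_pow]
    ring
  refine ⟨PowerSeries.mk fun n => coeff (n + (j + 1)) (bernoulliDeriv j) / j.factorial, ?_, ?_⟩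
  · ext n
    rw [coeff_C_mul, map_add, hjm, coeff_X_pow_mul', coeff_one]
    rcases Nat.lt_or_ge n (j + 1) with hn | hn
    · rw [if_neg hn.not_ge, add_zero, bernoulliDeriv, coeff_mk]
      by_cases hn0 : n = 0
      · subst hn0
        rw [hprod0]
        simp
      · rw [if_neg hn0, mul_zero, mul_eq_zero]
        right
        refine Finset.prod_eq_zero (Finset.mem_range.mpr (by omega : n - 1 < j)) ?_
        rw [Nat.cast_sub (by omega)]
        push_cast
        ring
    · rw [if_pos hn, if_neg (by omega), zero_add, coeff_mk, Nat.sub_add_cancel hn]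
      field_simp
  · rw [coeff_mk, zero_add, bernoulliDeriv, coeff_mk, hprod, hjm]
    field_simp

end Main

theorem mainTheorem3 (m : ℕ) (hm : 1 ≤ m) (h : ℝ) (hh : 0 < h) :
    (∃! D : ℤ → ℝ, IsDiscreteAnalogue m h D) ∧
    ∀ D : ℤ → ℝ, IsDiscreteAnalogue m h D →
      (∀ k : ℕ, k ≤ 2 * m - 1 →
        HasSum (fun β : ℤ => D β * (h * (β : ℝ)) ^ k) 0) ∧
      HasSum (fun β : ℤ => D β * (h * (β : ℝ)) ^ (2 * m)) ((2 * m).factorial : ℝ) ∧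
      (∀ k : ℕ, 2 * m + 1 ≤ k → k ≤ 4 * m - 1 →
        HasSum (fun β : ℤ => D β * (h * (β : ℝ)) ^ k) 0) ∧
      HasSum (fun β : ℤ => D β * (h * (β : ℝ)) ^ (4 * m))
        (h ^ (2 * m) * ((4 * m).factorial : ℝ) * (bernoulli (2 * m) : ℝ) /
          ((2 * m).factorial : ℝ)) := by
  have hh0 : (h : ℂ) ≠ 0 := by exact_mod_cast hh.ne'
  have hfac : ((2 * m - 1).factorial : ℂ) ≠ 0 := by exact_mod_cast Nat.factorial_ne_zero _
  set A := eulerianPoly (2 * m - 1) with hA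
  set c : ℂ := (h : ℂ) ^ (2 * m - 1) / ((2 * m - 1).factorial : ℂ) with hc
  have hc0 : c ≠ 0 := by positivity
  set q : Polynomial ℂ := (1 - Polynomial.X) ^ (2 * m) with hq
  have hg := one_sub_pow_fundamentalG hm hh
  obtain ⟨u, hu, hAu⟩ := RapidDecay.seqDelta.exists_aeval_eq (p := A)
    fun z hz => eulerianPoly_eval_ne_zero ⟨m - 1, by omega⟩ hz
  have hex := IsConv.of_factorisation hc0 (norm_fundamentalG_le m hh) hu hAu hg
  have hform (D : ℤ → ℝ) (hD : IsDiscreteAnalogue m h D) :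
      (fun n => (D n : ℂ)) = (h * c : ℂ)⁻¹ • Polynomial.aeval seqShift q u := by
    have hs : Summable fun γ => (h : ℂ) * D γ :=
      (Complex.summable_ofReal.mpr (hD.summable hh)).mul_left _
    have h1 := (isDiscreteAnalogue_iff.mp hD).eq_of_seqDelta hc0 hs hu hAu hg
    ext n
    have h2 := congrFun h1 n
    simp only [Pi.smul_apply, smul_eq_mul] at h2 ⊢
    rw [mul_inv, mul_assoc, ← h2, inv_mul_cancel_left₀ hh0]
  have hhc : (h : ℂ) * c * ((2 * m - 1).factorial : ℂ) = (h : ℂ) ^ (2 * m) := by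
    rw [hc, mul_assoc, div_mul_cancel₀ _ hfac, ← pow_succ', Nat.sub_add_cancel (by omega)]
  refine ⟨?_, fun D hD => ?_⟩
  · refine ⟨fun n => (h⁻¹ * ((c⁻¹ • Polynomial.aeval seqShift q u) n).re), fun β => ?_,
      fun D hD => ?_⟩
    · have := Complex.hasSum_re (hex β)
      convert this using 1
      · ext γ
        rw [Complex.re_mul_ofReal, ← mul_assoc, mul_inv_cancel_left₀ hh.ne']
      · by_cases hβ : β = 0 <;> simp [hβ, seqDelta]
    · ext n
      have h1 := congrArg Complex.re (congrFun (hform D hD) n)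
      rw [Complex.ofReal_re] at h1
      rw [h1, mul_inv, ← smul_smul, Pi.smul_apply, smul_eq_mul, ← Complex.ofReal_inv,
        Complex.re_ofReal_mul]
  have hrd : RapidDecay fun n => (D n : ℂ) := by
    rw [hform D hD]
    exact (hu.aeval_seqShift q).smul _
  obtain ⟨R, hR, hR0⟩ := bernoulliDeriv_odd hm
  have hM : PowerSeries.C ((h : ℂ) ^ (2 * m)) * momentSeries (fun n => (D n : ℂ)) *
      (1 + PowerSeries.X ^ (2 * m) * R) = PowerSeries.X ^ (2 * m) := by
    have h1 := X_pow_mul_aeval_exp_eulerianPoly (2 * m - 1)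
    rw [Nat.sub_add_cancel (by omega), hR] at h1
    have h2 := momentSeries_aeval hu A
    rw [hAu, momentSeries_seqDelta] at h2
    have h3 : PowerSeries.C ((h : ℂ) * c) * momentSeries (fun n => (D n : ℂ)) =
        (1 - PowerSeries.exp ℂ) ^ (2 * m) * momentSeries u := by
      rw [hform D hD, momentSeries_smul, ← mul_assoc, ← map_mul,
        mul_inv_cancel₀ (mul_ne_zero hh0 hc0), map_one, one_mul, momentSeries_aeval hu, hq]
      simp
    rw [← hhc, map_mul]
    linear_combination (PowerSeries.C ((2 * m - 1).factorial : ℂ) *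
      (1 + PowerSeries.X ^ (2 * m) * R)) * h3 - momentSeries u * h1 - PowerSeries.X ^ (2 * m) * h2
  have key (k : ℕ) (hk : k ≤ 4 * m) (s : ℝ) (hs : (s : ℂ) = (h : ℂ) ^ k * (k.factorial : ℂ) *
      (if k = 2 * m then 1 else if k = 2 * (2 * m) then -PowerSeries.coeff 0 R else 0) /
        (h : ℂ) ^ (2 * m)) : HasSum (fun β : ℤ => D β * (h * (β : ℝ)) ^ k) s := by
    have h1 := coeff_of_mul_eq_X_pow (by omega : 0 < 2 * m) hM (by omega : k ≤ 2 * (2 * m))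
    rw [PowerSeries.coeff_C_mul, momentSeries, PowerSeries.coeff_mk] at h1
    have hkf : (k.factorial : ℂ) ≠ 0 := by exact_mod_cast Nat.factorial_ne_zero _
    rw [← Complex.hasSum_ofReal, hs, ← h1]
    have h2 := (hrd.summable_mul_pow k).hasSum.mul_left ((h : ℂ) ^ k)
    generalize (∑' n : ℤ, (D n : ℂ) * (n : ℂ) ^ k) = t at h2 ⊢
    have h3 : (h : ℂ) ^ k * (k.factorial : ℂ) * ((h : ℂ) ^ (2 * m) * (t / (k.factorial : ℂ))) /
        (h : ℂ) ^ (2 * m) = (h : ℂ) ^ k * t := by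
      field_simp
    rw [h3]
    have h4 (β : ℤ) : ((D β * (h * (β : ℝ)) ^ k : ℝ) : ℂ) =
        (h : ℂ) ^ k * ((D β : ℂ) * (β : ℂ) ^ k) := by
      push_cast
      rw [mul_pow, mul_left_comm]
    simp only [h4]
    exact h2
  refine ⟨fun k hk => key k (by omega) _ ?_, key _ (by omega) _ ?_,
    fun k hk hk' => key k (by omega) _ ?_, key _ le_rfl _ ?_⟩
  · rw [if_neg (by omega), if_neg (by omega)]
    simp
  · simp
    field_simp
  · rw [if_neg (by omega), if_neg (by omega)]
    simp
  · rw [if_neg (by omega), if_pos (by omega), hR0, show 4 * m = 2 * m + 2 * m by ring, pow_add]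
    push_cast
    field_simp
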